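/- Let $m\neq 0$. In the conformal Gaussian gauge $(\tau,\rho)$ with $\kappa=\rho$, near the cylinder at spatial infinity $\rho=0$, the rescaled Schwarzschild spacetime of mass $m$ is described by functions $c^0,c^1,c^+=c^-=:c^\pm,f,\xi,\chi_2,\chi_h$ of $(\tau,\rho)$ with expansions $$c^0=-\tau+m\left(\tfrac43\tau^3-\tfrac13\tau^5\right)\rho+\tfrac{m^2}{2}\left(-\tfrac17\tau^9+\tfrac87\tau^7-3\tau^5-2\tau^3\right)\rho^2+O(\rho^3),$$ $$c^1=\rho+\tfrac m2\left(-4\tau^2+\tfrac23\tau^4\right)\rho^2+\tfrac{m^2}{6}\left(12\tau^2+15\tau^4-\tfrac{14}3\tau^6+\tfrac37\tau^8\right)\rho^3+O(\rho^4),$$ $$c^\pm=1+m\left(\tau^2-\tfrac16\tau^4\right)\rho+\tfrac{m^2}2\left(\tfrac1{14}\tau^8-\tfrac89\tau^6+3\tau^4-2\tau^2\right)\rho^2+O(\rho^3),$$ $$f=1+\tfrac m3\tau^4\rho+\tfrac{m^2}2\left(\tfrac17\tau^8-\tfrac49\tau^6+\tfrac13\tau^4-2\tau^2\right)\rho^2+O(\rho^3),$$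 $$\tfrac{\xi}{\sqrt2}=m\left(\tfrac12\tau^2-\tfrac14\tau^4\right)\rho+\tfrac{m^2}2\left(-\tfrac1{28}\tau^8-\tfrac29\tau^6+\tfrac43\tau^4\right)\rho^2+O(\rho^3),$$ $$\chi_2=m(4\tau^3-12\tau)\rho+\tfrac{m^2}2\left(24\tau-8\tau^3+4\tau^5-\tfrac4{21}\tau^7\right)\rho^2+O(\rho^3),\qquad \chi_h=\tfrac{m^2}2\left(-\tfrac{20}3\tau^3+\tfrac83\tau^5-\tfrac{20}{63}\tau^7\right)\rho^2+O(\rho^3).$$ Expand the components $\phi_0,\phi_1,\phi_2$ of a Maxwell field in spin-weighted harmonics indexed by $(q,k)$, $0\le k\le 2q$, and in powers of $\rho$; for $q\ge1$ let $\phi_j^{q,k}=\sum_{n\ge q}\frac1{n!}a_{j,n;q,k}(\tau)\rho^n$ be the $(q,k)$ part. The Maxwell equations in the $(q,k)$ sector (indices $q,k$ omitted, $s=\sqrt{q(q+1)}$) are $$(1-c^0)\partial_\tau\phi_0-c^1\partial_\rho\phi_0+s\,c^\pm\phi_1=\left(\sqrt2\,\xi+\tfrac16\chi_2-2\chi_h-f\right)\phi_0,$$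 $$\partial_\tau\phi_1+\tfrac s2c^\pm(\phi_2-\phi_0)=-\left(\tfrac13\chi_2+2\chi_h\right)\phi_1,$$ $$(1+c^0)\partial_\tau\phi_2+c^1\partial_\rho\phi_2-s\,c^\pm\phi_1=\left(-\sqrt2\,\xi+\tfrac16\chi_2-2\chi_h+f\right)\phi_2,$$ with the constraint $$-c^0\partial_\tau\phi_1-c^1\partial_\rho\phi_1+\tfrac s2c^\pm(\phi_2+\phi_0)=2\sqrt2\,\xi\,\phi_1.$$ The order-$n$ transport equations, for functions of $\tau\in(-1,1)$, are obtained by applying $\partial_\rho^n$ to these four equations and setting $\rho=0$. Initial data are complex numbers $a_{0,n;q,k}(0)$ and $a_{2,n;q,k}(0)$, zero unless $1\le q\le n$ and $0\le k\le2q$, and bounded in absolute value by $C r^n n!$ for some constants $C,r$. They satisfy the regularity condition if $a_{0,n;n,k}(0)=a_{2,n;n,k}(0)$ for all $n\ge1$ and $0\le k\le2n$. **Proposition.** There are initial data satisfying the regularity condition such that, for every $p\ge1$ and every $k=0,\dots,2p$, the transport equations of order $\le p+2$ in the $(p,k)$ sector (constraint included) have a solution on $(-1,1)$ with these data, and for every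 such solution each of the functions $a_{0,p+2;p,k}$, $a_{1,p+2;p,k}$, $a_{2,p+2;p,k}$ contains logarithmic divergences at both $\tau=1$ and $\tau=-1$: it has on $(-1,1)$ the form $$P(\tau)+P_-(\tau)\ln(1-\tau)+P_+(\tau)\ln(1+\tau)$$ with polynomials $P,P_-,P_+$ such that $P_-\not\equiv0$ and $P_+\not\equiv0$. -/

import Mathlib

open Polynomial

noncomputable section

namespace MaxwellSchwarzschild

/-! ### The conformal Schwarzschild background near the cylinder at spatial infinity

In the gauge based on conformal Gaussian coordinates `(τ, ρ)` with `κ = ρ`, the rescaled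
Schwarzschild metric of mass `m` is described by a frame with `e₀ = ∂_τ`,
`e₃ = c⁰ ∂_τ + c¹ ∂_ρ` and the angular factor `c^± `, by the 1-form component `f` of the Weyl
connection, by the component `ξ` and by the components `χ₂`, `χ_h` of the connection. All of them
are analytic in `(τ, ρ)` near `ρ = 0`.  Each function below sends `i` to the value at `ρ = 0` of the
`i`-th `ρ`-derivative, a polynomial in `τ`.  Only the orders written here (and the next one for
`c¹`, which vanishes at `ρ = 0`) enter the transport equations used below; the higher entries
are set to `0` and are never multiplied with a nonzero field coefficient. -/

/-- `ρ`-jet at `ρ = 0` of `c⁰`. -/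
def c0 (m : ℝ) : ℕ → ℝ → ℝ
  | 0, τ => -τ
  | 1, τ => m * (4 / 3 * τ ^ 3 - 1 / 3 * τ ^ 5)
  | 2, τ => m ^ 2 * (-(1 / 7) * τ ^ 9 + 8 / 7 * τ ^ 7 - 3 * τ ^ 5 - 2 * τ ^ 3)
  | _, _ => 0

/-- `ρ`-jet at `ρ = 0` of `c¹`. -/
def c1 (m : ℝ) : ℕ → ℝ → ℝ
  | 0, _ => 0
  | 1, _ => 1
  | 2, τ => m * (-4 * τ ^ 2 + 2 / 3 * τ ^ 4)
  | 3, τ => m ^ 2 * (12 * τ ^ 2 + 15 * τ ^ 4 - 14 / 3 * τ ^ 6 + 3 / 7 * τ ^ 8)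
  | _, _ => 0

/-- `ρ`-jet at `ρ = 0` of `c⁺ = c⁻`. -/
def cpm (m : ℝ) : ℕ → ℝ → ℝ
  | 0, _ => 1
  | 1, τ => m * (τ ^ 2 - 1 / 6 * τ ^ 4)
  | 2, τ => m ^ 2 * (1 / 14 * τ ^ 8 - 8 / 9 * τ ^ 6 + 3 * τ ^ 4 - 2 * τ ^ 2)
  | _, _ => 0

/-- `ρ`-jet at `ρ = 0` of `f`. -/
def f (m : ℝ) : ℕ → ℝ → ℝ
  | 0, _ => 1
  | 1, τ => m * (1 / 3 * τ ^ 4)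
  | 2, τ => m ^ 2 * (1 / 7 * τ ^ 8 - 4 / 9 * τ ^ 6 + 1 / 3 * τ ^ 4 - 2 * τ ^ 2)
  | _, _ => 0

/-- `ρ`-jet at `ρ = 0` of `ξ / √2`. -/
def xiDivSqrtTwo (m : ℝ) : ℕ → ℝ → ℝ
  | 0, _ => 0
  | 1, τ => m * (1 / 2 * τ ^ 2 - 1 / 4 * τ ^ 4)
  | 2, τ => m ^ 2 * (-(1 / 28) * τ ^ 8 - 2 / 9 * τ ^ 6 + 4 / 3 * τ ^ 4)
  | _, _ => 0

/-- `ρ`-jet at `ρ = 0` of `χ₂`. -/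
def chi2 (m : ℝ) : ℕ → ℝ → ℝ
  | 0, _ => 0
  | 1, τ => m * (4 * τ ^ 3 - 12 * τ)
  | 2, τ => m ^ 2 * (24 * τ - 8 * τ ^ 3 + 4 * τ ^ 5 - 4 / 21 * τ ^ 7)
  | _, _ => 0

/-- `ρ`-jet at `ρ = 0` of `χ_h`. -/
def chih (m : ℝ) : ℕ → ℝ → ℝ
  | 0, _ => 0
  | 1, _ => 0
  | 2, τ => m ^ 2 * (-(20 / 3) * τ ^ 3 + 8 / 3 * τ ^ 5 - 20 / 63 * τ ^ 7)
  | _, _ => 0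

/-- `ρ`-jet of `1 - c⁰`. -/
def oneSubC0 (m : ℝ) (i : ℕ) (τ : ℝ) : ℝ := (if i = 0 then 1 else 0) - c0 m i τ

/-- `ρ`-jet of `1 + c⁰`. -/
def oneAddC0 (m : ℝ) (i : ℕ) (τ : ℝ) : ℝ := (if i = 0 then 1 else 0) + c0 m i τ

/-- `ρ`-jet of `(2Γ₀₀₁₁ - 4Γ₁₀₁₀) / √2 = √2 ξ + χ₂ / 6 - 2 χ_h - f`. -/
def conn0 (m : ℝ) (i : ℕ) (τ : ℝ) : ℝ :=
  2 * xiDivSqrtTwo m i τ + chi2 m i τ / 6 - 2 * chih m i τ - f m i τ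

/-- `ρ`-jet of `2(Γ₁₁₀₀ + Γ₀₀₁₁) / √2 = - χ₂ / 3 - 2 χ_h`. -/
def conn1 (m : ℝ) (i : ℕ) (τ : ℝ) : ℝ :=
  -(chi2 m i τ) / 3 - 2 * chih m i τ

/-- `ρ`-jet of `(2Γ₁₁₀₀ - 4Γ₀₁₀₁) / √2 = - √2 ξ + χ₂ / 6 - 2 χ_h + f`. -/
def conn2 (m : ℝ) (i : ℕ) (τ : ℝ) : ℝ :=
  -2 * xiDivSqrtTwo m i τ + chi2 m i τ / 6 - 2 * chih m i τ + f m i τ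

/-- `ρ`-jet of `2(Γ₀₀₁₁ - Γ₁₁₀₀) / √2 = 2 √2 ξ`. -/
def connC (m : ℝ) (i : ℕ) (τ : ℝ) : ℝ :=
  4 * xiDivSqrtTwo m i τ

/-! ### Transport equations for the modes of the Maxwell field

Fix a harmonic `(q, k)`.  The coefficients of `φ₀, φ₁, φ₂` in this harmonic have the expansions
`φ_j = ∑ₙ (1 / n!) a j n (τ) ρⁿ`, so that `a j n` is the `n`-th `ρ`-derivative at `ρ = 0`. -/

/-- The `n`-th `ρ`-derivative at `ρ = 0` of a product, by the Leibniz rule. -/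
def leibniz (c : ℕ → ℝ → ℝ) (y : ℕ → ℝ → ℂ) (n : ℕ) (τ : ℝ) : ℂ :=
  ∑ i ∈ Finset.range (n + 1), (n.choose i : ℂ) * (c i τ : ℂ) * y (n - i) τ

/-- The `ρ`-jet of `∂_τ y`. -/
def dTau (y : ℕ → ℝ → ℂ) (n : ℕ) (τ : ℝ) : ℂ := deriv (y n) τ

/-- The `ρ`-jet of `∂_ρ y`. -/
def dRho (y : ℕ → ℝ → ℂ) (n : ℕ) : ℝ → ℂ := y (n + 1)

/-- The factor `√(q(q+1))` by which `X_±` acts on the harmonics, up to sign. -/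
def ladder (q : ℕ) : ℝ := Real.sqrt (q * (q + 1))

/-- Order-`n` transport equation for `φ₀`: the `n`-th `ρ`-derivative at `ρ = 0` of
`(1 - c⁰) ∂_τ φ₀ - c¹ ∂_ρ φ₀ + c⁺ X₊ φ₁ = (√2 ξ + χ₂/6 - 2χ_h - f) φ₀`.  Its principal part is
`(1 + τ) a₀' + √(q(q+1)) a₁ - (n - 1) a₀`. -/
def Transport0 (m : ℝ) (q : ℕ) (a : Fin 3 → ℕ → ℝ → ℂ) (n : ℕ) (τ : ℝ) : Prop :=
  leibniz (oneSubC0 m) (dTau (a 0)) n τ - leibniz (c1 m) (dRho (a 0)) n τ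
    + ladder q * leibniz (cpm m) (a 1) n τ = leibniz (conn0 m) (a 0) n τ

/-- Order-`n` transport equation for `φ₁`: the `n`-th `ρ`-derivative at `ρ = 0` of
`∂_τ φ₁ + ½ (c⁺ X₊ φ₂ + c⁻ X₋ φ₀) = -(χ₂/3 + 2χ_h) φ₁`.  Its principal part is
`a₁' + ½ √(q(q+1)) (a₂ - a₀)`. -/
def Transport1 (m : ℝ) (q : ℕ) (a : Fin 3 → ℕ → ℝ → ℂ) (n : ℕ) (τ : ℝ) : Prop :=
  dTau (a 1) n τ
    + ladder q / 2 * (leibniz (cpm m) (a 2) n τ - leibniz (cpm m) (a 0) n τ)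
    = leibniz (conn1 m) (a 1) n τ

/-- Order-`n` transport equation for `φ₂`: the `n`-th `ρ`-derivative at `ρ = 0` of
`(1 + c⁰) ∂_τ φ₂ + c¹ ∂_ρ φ₂ + c⁻ X₋ φ₁ = (-√2 ξ + χ₂/6 - 2χ_h + f) φ₂`.  Its principal part is
`(1 - τ) a₂' - √(q(q+1)) a₁ + (n - 1) a₂`. -/
def Transport2 (m : ℝ) (q : ℕ) (a : Fin 3 → ℕ → ℝ → ℂ) (n : ℕ) (τ : ℝ) : Prop :=
  leibniz (oneAddC0 m) (dTau (a 2)) n τ + leibniz (c1 m) (dRho (a 2)) n τ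
    - ladder q * leibniz (cpm m) (a 1) n τ = leibniz (conn2 m) (a 2) n τ

/-- Order-`n` constraint: the `n`-th `ρ`-derivative at `ρ = 0` of
`-c⁰ ∂_τ φ₁ - c¹ ∂_ρ φ₁ + ½ (c⁺ X₊ φ₂ - c⁻ X₋ φ₀) = 2√2 ξ φ₁`.  Its principal part is
`τ a₁' + ½ √(q(q+1)) (a₂ + a₀) - n a₁`. -/
def TransportC (m : ℝ) (q : ℕ) (a : Fin 3 → ℕ → ℝ → ℂ) (n : ℕ) (τ : ℝ) : Prop :=
  -leibniz (c0 m) (dTau (a 1)) n τ - leibniz (c1 m) (dRho (a 1)) n τ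
    + ladder q / 2 * (leibniz (cpm m) (a 2) n τ + leibniz (cpm m) (a 0) n τ)
    = leibniz (connC m) (a 1) n τ

/-! ### Initial data and solutions -/

/-- Freely specifiable initial data on `{τ = 0}`, through the coefficients `a_{0,n;q,k}(0)` and
`a_{2,n;q,k}(0)` of `ρⁿ/n!` times the `(q, k)` harmonic in `φ₀` and `φ₂`.  The order `n` contains at
most `2ⁿ`-polar harmonics, and the power series in `ρ` has positive radius of convergence.
The coefficients of `φ₁` with `q ≥ 1` follow from the constraint. -/
structure InitialData where
  coeff0 : ℕ → ℕ → ℕ → ℂ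
  coeff2 : ℕ → ℕ → ℕ → ℂ
  support0 : ∀ n q k, coeff0 n q k ≠ 0 → 1 ≤ q ∧ q ≤ n ∧ k ≤ 2 * q
  support2 : ∀ n q k, coeff2 n q k ≠ 0 → 1 ≤ q ∧ q ≤ n ∧ k ≤ 2 * q
  convergent : ∃ C r : ℝ, ∀ n q k,
    ‖coeff0 n q k‖ ≤ C * r ^ n * n.factorial ∧ ‖coeff2 n q k‖ ≤ C * r ^ n * n.factorial

/-- The regularity condition: the `2ⁿ`-polar parts of `φ₀` and `φ₂` at order `n` agree. -/
def InitialData.Regular (d : InitialData) : Prop :=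
  ∀ n k : ℕ, 1 ≤ n → k ≤ 2 * n → d.coeff0 n n k = d.coeff2 n n k

/-- The coefficients `a j n = a_{j,n;q,k}` in the `(q, k)` sector solve, for `-1 < τ < 1`, all
transport equations (propagation and constraint) of order `n ≤ q + 2` with initial data `d`.
Harmonics with index `q` are absent at orders `n < q`. Consequently only background terms with at
most two `ρ`-derivatives (three for `c¹`) contribute. -/
structure IsSectorSolution (m : ℝ) (d : InitialData) (q k : ℕ) (a : Fin 3 → ℕ → ℝ → ℂ) :
    Prop where
  differentiable : ∀ j, ∀ n ≤ q + 2, ∀ τ ∈ Set.Ioo (-1 : ℝ) 1, DifferentiableAt ℝ (a j n) τ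
  absent : ∀ j, ∀ n < q, ∀ τ ∈ Set.Ioo (-1 : ℝ) 1, a j n τ = 0
  transport0 : ∀ n ≤ q + 2, ∀ τ ∈ Set.Ioo (-1 : ℝ) 1, Transport0 m q a n τ
  transport1 : ∀ n ≤ q + 2, ∀ τ ∈ Set.Ioo (-1 : ℝ) 1, Transport1 m q a n τ
  transport2 : ∀ n ≤ q + 2, ∀ τ ∈ Set.Ioo (-1 : ℝ) 1, Transport2 m q a n τ
  constraint : ∀ n ≤ q + 2, ∀ τ ∈ Set.Ioo (-1 : ℝ) 1, TransportC m q a n τ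
  initial0 : ∀ n ≤ q + 2, a 0 n 0 = d.coeff0 n q k
  initial2 : ∀ n ≤ q + 2, a 2 n 0 = d.coeff2 n q k

/-- `g` is, on `(-1, 1)`, of the form `P + P₋ ln(1 - τ) + P₊ ln(1 + τ)` with polynomials
`P, P₋, P₊` where both `P₋` and `P₊` are nonzero: it contains logarithmic divergences at
`τ = 1` and at `τ = -1`. -/
def HasLogDivergences (g : ℝ → ℂ) : Prop :=
  ∃ P Pminus Pplus : ℂ[X], Pminus ≠ 0 ∧ Pplus ≠ 0 ∧
    ∀ τ ∈ Set.Ioo (-1 : ℝ) 1,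
      g τ = P.eval (τ : ℂ) + Pminus.eval (τ : ℂ) * (Real.log (1 - τ) : ℂ)
        + Pplus.eval (τ : ℂ) * (Real.log (1 + τ) : ℂ)

end MaxwellSchwarzschild

end

/-!
The data vanish at order `q` in every `(q, k)` sector, which is compatible with the regularity
condition, and are antisymmetric at order `q + 1`: `a₀ = 1`, `a₂ = -1`. This part of the data, free
under the regularity condition, is what produces logarithms at order `q + 2` when `m ≠ 0`.

Write `w = 1 - τ²`, `s = √(p(p+1))` and `Y(τ) = ∫₀^τ (1 - t²)^p dt`. At order `p + 1` the equations
are still homogeneous and the solution is `a₁ = s Y`, with `a₀`, `a₂` polynomials in `τ`, `Y`, `w^p`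
(`orderOne`). At order `p + 2` only the terms linear in `m` of the background act on it. The
propagation equation of `φ₁` and the constraint determine `a₀` and `a₂` algebraically from `a₁` and
`a₁'`, and for `a₁ = s u` the two remaining equations both reduce to
`w u'' + 2 (p + 1) (τ u' - u) = S`, with the polynomial `S` in `τ`, `Y` and `w^(p-1)` (`source`).
For `g = τ u' - u` this is the first-order equation `w g' + 2 (p + 1) τ g = τ S`, that is
`(g / w^(p+1))' = τ S / w^(p+2)`. The right-hand side has nonzero residues at `τ = ±1`: with
`L = ½ (ln (1 + τ) - ln (1 - τ))` one finds `g = -4 m (p + 2) w^(p+1) L + G` for an explicit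
polynomial `G` (`gPoly`, `eval_gPoly_ode`). Integrating `u'' = (S - 2 (p + 1) g) / w` once more,
with `κ = Y(1) = -Y(-1)`, gives
`u' = 2 m (p + 2) (Z₊' ln (1 + τ) - Z₋' ln (1 - τ)) + V`, where
`Z± = 2 (p + 1) τ (Y ± κ) + w^(p+1)` (`zPoly`) and `w V'` is a polynomial that vanishes at `±1`, so
that `V` is a polynomial (`exists_vPoly`). Hence all three coefficients at order `p + 2` have the
asserted form, and the polynomials in front of the logarithms are nonzero because
`Z±'' = 2 (p + 1) w^p` (`zPoly_combination_ne_zero`).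

Every solution agrees on `(-1, 1)` with this one up to order `p + 2`
(`IsSectorSolution.unique`): by induction on the order, the difference of two solutions satisfies a
homogeneous linear system that is regular on `(-1, 1)`; its components `0` and `2` vanish at
`τ = 0` by the choice of data, its component `1` by the constraint.
-/

open Polynomial

noncomputable section

namespace MaxwellSchwarzschild

/-! ### Polynomials in `τ`, `1 - τ²` and its integrated powers -/

theorem exists_primitive (P : ℂ[X]) : ∃ Q : ℂ[X], derivative Q = P ∧ Q.eval 0 = 0 := by
  induction P using Polynomial.induction_on' with
  | add P Q hP hQ =>
    obtain ⟨A, hA, hA0⟩ := hP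
    obtain ⟨B, hB, hB0⟩ := hQ
    exact ⟨A + B, by simp [hA, hB], by simp [hA0, hB0]⟩
  | monomial n a =>
    refine ⟨monomial (n + 1) (a / (n + 1)), ?_, by simp⟩
    have : (n : ℂ) + 1 ≠ 0 := Nat.cast_add_one_ne_zero n
    rw [derivative_monomial]
    push_cast
    rw [div_mul_cancel₀ _ this]

/-- The primitive of a polynomial that vanishes at `0`. -/
def primitive (P : ℂ[X]) : ℂ[X] := (exists_primitive P).choose

theorem derivative_primitive (P : ℂ[X]) : derivative (primitive P) = P :=
  (exists_primitive P).choose_spec.1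

theorem eval_zero_primitive (P : ℂ[X]) : (primitive P).eval 0 = 0 :=
  (exists_primitive P).choose_spec.2

/-- The polynomial `1 - τ²`, which vanishes at both critical sets `τ = ±1`. -/
def wPoly : ℂ[X] := 1 - X ^ 2

theorem eval_wPoly (t : ℂ) : wPoly.eval t = 1 - t ^ 2 := by simp [wPoly]

theorem derivative_wPoly : derivative wPoly = -2 * X := by
  simp [wPoly, derivative_pow, C_ofNat]

theorem wPoly_mul_derivative_pow (n : ℕ) :
    wPoly * derivative (wPoly ^ n) = (n : ℂ[X]) * (-2 * X) * wPoly ^ n := by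
  rw [derivative_pow, derivative_wPoly]
  rcases n with _ | n
  · simp
  · simp only [Nat.add_sub_cancel, C_eq_natCast]
    ring

theorem derivative_wPoly_pow_succ (n : ℕ) :
    derivative (wPoly ^ (n + 1)) = ((n : ℂ[X]) + 1) * (-2 * X) * wPoly ^ n := by
  rw [derivative_pow, derivative_wPoly]
  simp only [Nat.add_sub_cancel, C_eq_natCast]
  push_cast
  ring

/-- `∫₀^τ (1 - t²)^p dt`. -/
def yPoly (p : ℕ) : ℂ[X] := primitive (wPoly ^ p)

theorem derivative_yPoly (p : ℕ) : derivative (yPoly p) = wPoly ^ p := derivative_primitive _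

theorem eval_zero_yPoly (p : ℕ) : (yPoly p).eval 0 = 0 := eval_zero_primitive _

/-- `∫₀^τ (1 - t²)^p dt` is an odd function of `τ`. -/
theorem eval_neg_one_yPoly (p : ℕ) : (yPoly p).eval (-1) = -(yPoly p).eval 1 := by
  have h : derivative (yPoly p + (yPoly p).comp (-X)) = 0 := by
    simp [derivative_comp, derivative_yPoly, wPoly]
  have h2 := eq_C_of_derivative_eq_zero h
  have h0 := congrArg (eval 0) h2
  have h1 := congrArg (eval 1) h2
  simp only [eval_add, eval_comp, eval_neg, eval_X, neg_zero, eval_zero_yPoly, eval_C] at h0 h1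
  rw [← h0] at h1
  linear_combination h1

/-! ### The second-order equation for `φ₁` at order `p + 2` -/

/-- The inhomogeneity `S` of the equation `w u'' + 2 (p + 1) (τ u' - u) = S` that the coefficient
`√(p(p+1)) u` of `φ₁` at order `p + 2` satisfies. -/
def source (m : ℂ) (p : ℕ) : ℂ[X] :=
  C (m * (p + 2)) * ((4 - C (6 * p ^ 2 + 2 * p + 4 : ℂ) * X ^ 2 + C ((p - 1) ^ 2 : ℂ) * X ^ 4)
      * yPoly p
    + wPoly ^ (p - 1) * X * (4 + C (20 * p / 3 - 8 : ℂ) * X ^ 2 + C (7 - 8 * p / 3 : ℂ) * X ^ 4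
      - 3 * X ^ 6))

/-- The polynomial part `G` of `g = τ u' - u`. It solves the first-order equation for `g` with
`τ S + 4 m (p + 2) w^(p+1)` in place of `τ S`; the additional term is compensated by
`-2 m (p + 2) w^(p+1) (ln (1 + τ) - ln (1 - τ))`. For `p ≥ 1` only; at `p = 0` the formula divides
by zero. -/
def gPoly (m : ℂ) (p : ℕ) : ℂ[X] :=
  C (m * (p + 2)) * ((C (-(5 * p - 1) / 2 : ℂ) + C ((2 * p + 1) * (p + 1) / p : ℂ) * wPoly
      + C ((p - 1) / 2 : ℂ) * wPoly ^ 2) * yPoly p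
    + wPoly ^ (p - 1) * (C (2 * p + 4 - (2 * p + 1) * (p + 1) / p : ℂ) * X
      + C (2 * ((2 * p + 1) * (p + 1) / p) - 3 * p - 17 / 3 : ℂ) * X ^ 3
      + C ((11 * p + 5) / 6 - (2 * p + 1) * (p + 1) / p : ℂ) * X ^ 5
      + C ((p + 5) / 6 : ℂ) * X ^ 7))

theorem eval_gPoly_ode (m : ℂ) {p : ℕ} (hp : 1 ≤ p) (t : ℂ) :
    wPoly.eval t * (derivative (gPoly m p)).eval t + 2 * (p + 1) * t * (gPoly m p).eval t
      - 4 * m * (p + 2) * wPoly.eval t ^ (p + 1) = t * (source m p).eval t := by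
  obtain ⟨r, rfl⟩ : ∃ r, p = r + 1 := ⟨p - 1, by omega⟩
  have hr : (r : ℂ) + 1 ≠ 0 := Nat.cast_add_one_ne_zero r
  have h1 := congrArg (eval t) (wPoly_mul_derivative_pow r)
  have h2 := congrArg (eval t) (derivative_yPoly (r + 1))
  simp only [eval_mul, eval_pow, eval_natCast, eval_X, eval_neg, eval_ofNat] at h1 h2
  simp only [gPoly, source, Nat.add_sub_cancel, derivative_mul, derivative_add, derivative_C,
    derivative_X, derivative_X_pow, derivative_wPoly, derivative_pow wPoly 2, eval_add, eval_mul,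
    eval_sub, eval_C, eval_pow, eval_X, h2, eval_neg, eval_ofNat, eval_one,
    eval_zero]
  generalize (derivative (wPoly ^ r)).eval t = D at *
  generalize (yPoly (r+1)).eval t = y at *
  simp only [eval_wPoly] at *
  have h3 : ((1 - t ^ 2) ^ (r + 1 + 1) : ℂ) = (1 - t ^ 2) ^ 2 * (1 - t ^ 2) ^ r := by ring
  have h4 : ((1 - t ^ 2) ^ (r + 1) : ℂ) = (1 - t ^ 2) * (1 - t ^ 2) ^ r := by ring
  rw [h3, h4]
  generalize (1 - t ^ 2) ^ r = W at *
  push_cast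
  generalize (r : ℂ) = q at *
  simp only [pow_one]
  have hb : ∃ b : ℂ, (2 * (q + 1) + 1) * (q + 1 + 1) / (q + 1) = b ∧
    (2 * (q + 1) + 1) * (q + 1 + 1) = b * (q + 1) := ⟨_, rfl, by field_simp⟩
  obtain ⟨b, hb1, hb2⟩ := hb
  rw [hb1]
  linear_combination (m * (q + 3) * ((2 * q + 6 - b) * t + (2 * b - 3 * q - 26 / 3) * t ^ 3
    + ((11 * q + 16) / 6 - b) * t ^ 5 + (q + 6) / 6 * t ^ 7)) * h1
    - (2 * m * (q + 3) * (1 - t ^ 2) * t * y) * hb2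

/-- The solution `Z = 2 (p + 1) τ (Y + κ) + w^(p+1)` of the homogeneous equation
`w Z'' + 2 (p + 1) (τ Z' - Z) = 0`. With `κ = Y(1)` it vanishes to high order at `τ = -1` and
multiplies `ln (1 + τ)` in `u`; with `κ = -Y(1)` it vanishes at `τ = 1` and multiplies
`ln (1 - τ)`, in both cases up to a constant factor. -/
def zPoly (p : ℕ) (κ : ℂ) : ℂ[X] :=
  C (2 * (p + 1) : ℂ) * X * (yPoly p + C κ) + wPoly ^ (p + 1)

theorem derivative_zPoly (p : ℕ) (κ : ℂ) :
    derivative (zPoly p κ) = C (2 * (p + 1) : ℂ) * (yPoly p + C κ) := by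
  simp only [zPoly, derivative_add, derivative_mul, derivative_C, derivative_X,
    derivative_yPoly, derivative_wPoly_pow_succ]
  have : (C (2 * (p + 1) : ℂ)) = 2 * ((p : ℂ[X]) + 1) := by simp [C_ofNat]
  rw [this]
  ring

theorem derivative_derivative_zPoly (p : ℕ) (κ : ℂ) :
    derivative (derivative (zPoly p κ)) = C (2 * (p + 1) : ℂ) * wPoly ^ p := by
  simp [derivative_zPoly, derivative_yPoly]

theorem zPoly_ne_zero (p : ℕ) (κ : ℂ) : zPoly p κ ≠ 0 := by
  intro h
  have := congrArg (eval 0) h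
  simp [zPoly, wPoly] at this

/-- For `σ = ±1` this is the combination of `Z` and `Z'` in front of a logarithm in `φ₀` and `φ₂`.
Its second derivative at `0` is `2 p (p + 1)`, whatever `κ` and `σ` are. -/
theorem zPoly_combination_ne_zero {p : ℕ} (hp : 1 ≤ p) (κ σ : ℂ) :
    C (p + 2 : ℂ) * zPoly p κ + (C σ - X) * derivative (zPoly p κ) ≠ 0 := by
  intro h
  obtain ⟨r, rfl⟩ : ∃ r, p = r + 1 := ⟨p - 1, by omega⟩
  have h2 := congrArg (fun Q => eval 0 (derivative (derivative Q))) h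
  have hr : (r : ℂ) + 1 ≠ 0 := Nat.cast_add_one_ne_zero r
  have hr' : (r : ℂ) + 1 + 1 ≠ 0 := by exact_mod_cast Nat.succ_ne_zero (r + 1)
  simp only [derivative_add, derivative_mul, derivative_C, derivative_sub, derivative_X,
    derivative_derivative_zPoly, derivative_zero, eval_zero, eval_add, eval_mul,
    eval_sub, eval_C, eval_X, derivative_wPoly_pow_succ, eval_pow, eval_wPoly, eval_neg,
    eval_one, eval_ofNat, eval_natCast] at h2
  push_cast at h2
  have : ((r : ℂ) + 1) * (r + 1 + 1) = 0 := by
    norm_num at h2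
    linear_combination h2 / 2
  exact mul_ne_zero hr hr' this

theorem exists_wPoly_mul_derivative (Z : ℂ[X]) (h1 : Z.eval 1 = 0) (h2 : Z.eval (-1) = 0) :
    ∃ V : ℂ[X], wPoly * derivative V = Z ∧ V.eval 0 = 0 := by
  obtain ⟨A, rfl⟩ := dvd_iff_isRoot.2 h1
  have h3 : A.eval (-1) = 0 := by
    simp only [eval_mul, eval_sub, eval_X, eval_C] at h2
    exact (mul_eq_zero.1 h2).resolve_left (by norm_num)
  obtain ⟨B, rfl⟩ := dvd_iff_isRoot.2 h3
  refine ⟨primitive (-B), ?_, eval_zero_primitive _⟩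
  rw [derivative_primitive, wPoly]
  simp only [C_neg, C_1]
  ring

/-- The polynomial part `V` of `u'` exists: the expression required for `w V'` vanishes at
`τ = ±1`, so that it can be divided by `w` and no logarithms other than those in `Z± ln (1 ± τ)`
arise. -/
theorem exists_vPoly (m : ℂ) {p : ℕ} (hp : 1 ≤ p) :
    ∃ V : ℂ[X], wPoly * derivative V = source m p - C (2 * (p + 1) : ℂ) * gPoly m p
      - C (8 * m * (p + 2) * (p + 1) : ℂ) * (yPoly p - C ((yPoly p).eval 1) * X) ∧
      V.eval 0 = 0 := by
  -- At `τ = ±1` the equation for `G` reads `2 (p + 1) G = S`.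
  apply exists_wPoly_mul_derivative
  · have := eval_gPoly_ode m hp 1
    simp only [eval_wPoly, one_pow, sub_self, zero_mul, zero_pow (Nat.succ_ne_zero _)] at this
    simp only [eval_sub, eval_mul, eval_C, eval_X]
    linear_combination -this
  · have := eval_gPoly_ode m hp (-1)
    simp only [eval_wPoly, even_two, Even.neg_pow, one_pow, sub_self, zero_mul,
      zero_pow (Nat.succ_ne_zero _)] at this
    simp only [eval_sub, eval_mul, eval_C, eval_X, eval_neg_one_yPoly]
    linear_combination this

/-- The polynomial part `V` of `u'`, normalized by `V(0) = 0`. The value for `p = 0` is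
irrelevant. -/
def vPoly (m : ℂ) (p : ℕ) : ℂ[X] :=
  if hp : 1 ≤ p then (exists_vPoly m hp).choose else 0

theorem eval_vPoly (m : ℂ) {p : ℕ} (hp : 1 ≤ p) (t : ℂ) :
    wPoly.eval t * (derivative (vPoly m p)).eval t = (source m p).eval t
      - 2 * (p + 1) * (gPoly m p).eval t
      - 8 * m * (p + 2) * (p + 1) * ((yPoly p).eval t - (yPoly p).eval 1 * t) := by
  have := congrArg (eval t) (exists_vPoly m hp).choose_spec.1
  simp only [eval_sub, eval_mul, eval_C, eval_X] at this
  simpa [vPoly, hp] using this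

theorem eval_zero_vPoly (m : ℂ) {p : ℕ} (hp : 1 ≤ p) : (vPoly m p).eval 0 = 0 := by
  simpa [vPoly, hp] using (exists_vPoly m hp).choose_spec.2

/-! ### The logarithmic solution of the second-order equation -/

/-- The function `P + P₋ ln (1 - τ) + P₊ ln (1 + τ)`. -/
def logForm (P Pminus Pplus : ℂ[X]) (τ : ℝ) : ℂ :=
  P.eval (τ : ℂ) + Pminus.eval (τ : ℂ) * (Real.log (1 - τ) : ℂ)
    + Pplus.eval (τ : ℂ) * (Real.log (1 + τ) : ℂ)

theorem hasDerivAt_eval_ofReal (P : ℂ[X]) (τ : ℝ) :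
    HasDerivAt (fun x : ℝ => P.eval (x : ℂ)) ((derivative P).eval (τ : ℂ)) τ :=
  (P.hasDerivAt (τ : ℂ)).comp_ofReal

theorem hasDerivAt_logForm (P Pminus Pplus : ℂ[X]) {τ : ℝ} (hτ : τ ∈ Set.Ioo (-1 : ℝ) 1) :
    HasDerivAt (logForm P Pminus Pplus)
      (logForm (derivative P) (derivative Pminus) (derivative Pplus) τ
        - Pminus.eval (τ : ℂ) / (1 - τ) + Pplus.eval (τ : ℂ) / (1 + τ)) τ := by
  have hm : HasDerivAt (fun x : ℝ => (Real.log (1 - x) : ℂ)) (((-1) / (1 - τ) : ℝ) : ℂ) τ :=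
    (((hasDerivAt_id τ).const_sub 1).log (by simp; linarith [hτ.2])).ofReal_comp
  have hq : HasDerivAt (fun x : ℝ => (Real.log (1 + x) : ℂ)) ((1 / (1 + τ) : ℝ) : ℂ) τ :=
    (((hasDerivAt_id τ).const_add 1).log (by simp; linarith [hτ.1])).ofReal_comp
  refine (((hasDerivAt_eval_ofReal P τ).add ((hasDerivAt_eval_ofReal Pminus τ).mul hm)).add
    ((hasDerivAt_eval_ofReal Pplus τ).mul hq)).congr_deriv ?_
  simp only [logForm]
  push_cast
  ring

/-- The coefficient `u` of `φ₁` at order `p + 2`, divided by `√(p(p+1))`. Its polynomial part is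
`τ V - G` because `u = τ u' - g`. -/
def uForm (m : ℂ) (p : ℕ) : ℝ → ℂ :=
  logForm (X * vPoly m p - gPoly m p) (C (-2 * m * (p + 2)) * zPoly p (-(yPoly p).eval 1))
    (C (2 * m * (p + 2)) * zPoly p ((yPoly p).eval 1))

/-- The derivative of `uForm` on `(-1, 1)`, see `hasDerivAt_uForm`. -/
def duForm (m : ℂ) (p : ℕ) : ℝ → ℂ :=
  logForm (vPoly m p) (C (-2 * m * (p + 2)) * derivative (zPoly p (-(yPoly p).eval 1)))
    (C (2 * m * (p + 2)) * derivative (zPoly p ((yPoly p).eval 1)))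

theorem one_sub_ne_zero_of_mem {τ : ℝ} (hτ : τ ∈ Set.Ioo (-1 : ℝ) 1) : (1 : ℂ) - τ ≠ 0 := by
  have : (1 : ℝ) - τ ≠ 0 := by linarith [hτ.2]
  exact_mod_cast this

theorem one_add_ne_zero_of_mem {τ : ℝ} (hτ : τ ∈ Set.Ioo (-1 : ℝ) 1) : (1 : ℂ) + τ ≠ 0 := by
  have : (1 : ℝ) + τ ≠ 0 := by linarith [hτ.1]
  exact_mod_cast this

/-- The poles `Z₋ / (1 - τ)` and `Z₊ / (1 + τ)` from differentiating the logarithms are absorbed by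
the polynomial part, through the equations for `G` and `V`. -/
theorem hasDerivAt_uForm (m : ℂ) {p : ℕ} (hp : 1 ≤ p) {τ : ℝ} (hτ : τ ∈ Set.Ioo (-1 : ℝ) 1) :
    HasDerivAt (uForm m p) (duForm m p τ) τ := by
  refine (hasDerivAt_logForm _ _ _ hτ).congr_deriv ?_
  have h1 := one_sub_ne_zero_of_mem hτ
  have h2 := one_add_ne_zero_of_mem hτ
  have hg := eval_gPoly_ode m hp τ
  have hv := eval_vPoly m hp τ
  simp only [duForm, logForm, derivative_mul, derivative_C, derivative_sub, derivative_X,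
    eval_add, eval_sub, eval_mul, eval_C, eval_X, eval_one, eval_zero, zPoly, eval_pow]
  rw [eval_wPoly] at *
  generalize (derivative (vPoly m p)).eval (τ : ℂ) = V' at *
  generalize (derivative (gPoly m p)).eval (τ : ℂ) = G' at *
  field_simp
  linear_combination τ * hv - hg

theorem exists_hasDerivAt_duForm (m : ℂ) {p : ℕ} (hp : 1 ≤ p) {τ : ℝ}
    (hτ : τ ∈ Set.Ioo (-1 : ℝ) 1) :
    ∃ ddu : ℂ, HasDerivAt (duForm m p) ddu τ ∧
      (1 - (τ : ℂ) ^ 2) * ddu + 2 * (p + 1) * (τ * duForm m p τ - uForm m p τ)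
        = (source m p).eval (τ : ℂ) := by
  refine ⟨_, hasDerivAt_logForm _ _ _ hτ, ?_⟩
  have h1 := one_sub_ne_zero_of_mem hτ
  have h2 := one_add_ne_zero_of_mem hτ
  have hv := eval_vPoly m hp τ
  simp only [uForm, duForm, logForm, derivative_zPoly]
  simp only [derivative_mul, derivative_C, derivative_yPoly, derivative_add, eval_add, eval_sub,
    eval_mul, eval_C, eval_X, eval_zero, zPoly, eval_pow]
  rw [eval_wPoly] at *
  have hdiv : ∀ a b : ℂ, (1 - (τ : ℂ) ^ 2) * (-a / (1 - τ) + b / (1 + τ))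
      = -(1 + τ) * a + (1 - τ) * b := by
    intro a b
    field_simp
    ring
  have := hdiv (-2 * m * (p + 2) * (2 * (p + 1) * ((yPoly p).eval (τ : ℂ) + -(yPoly p).eval 1)))
    (2 * m * (p + 2) * (2 * (p + 1) * ((yPoly p).eval (τ : ℂ) + (yPoly p).eval 1)))
  linear_combination hv + this

/-! ### Leibniz sums of jets with few nonzero entries -/

theorem leibniz_eq_zero (c : ℕ → ℝ → ℝ) {y : ℕ → ℝ → ℂ} {n : ℕ} {τ : ℝ}
    (h : ∀ k ≤ n, y k τ = 0) : leibniz c y n τ = 0 :=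
  Finset.sum_eq_zero fun i _ => by rw [h _ (Nat.sub_le n i), mul_zero]

/-- If `y` starts at order `n`, only the top term of its `n`-th Leibniz sum survives. -/
theorem leibniz_self (c : ℕ → ℝ → ℝ) {y : ℕ → ℝ → ℂ} {n : ℕ} {τ : ℝ}
    (h : ∀ k < n, y k τ = 0) : leibniz c y n τ = c 0 τ * y n τ := by
  rw [leibniz, Finset.sum_range_succ', Finset.sum_eq_zero]
  · simp
  · intro i hi
    rw [Finset.mem_range] at hi
    rw [h _ (by omega), mul_zero]

theorem leibniz_add_one (c : ℕ → ℝ → ℝ) {y : ℕ → ℝ → ℂ} {n : ℕ} {τ : ℝ}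
    (h : ∀ k < n, y k τ = 0) :
    leibniz c y (n + 1) τ = c 0 τ * y (n + 1) τ + (n + 1) * c 1 τ * y n τ := by
  rw [leibniz, Finset.sum_range_succ', Finset.sum_range_succ', Finset.sum_eq_zero]
  · simp
    ring
  · intro i hi
    rw [Finset.mem_range] at hi
    rw [h _ (by omega), mul_zero]

theorem leibniz_add_two (c : ℕ → ℝ → ℝ) {y : ℕ → ℝ → ℂ} {n : ℕ} {τ : ℝ}
    (h : ∀ k < n, y k τ = 0) :
    leibniz c y (n + 2) τ = c 0 τ * y (n + 2) τ + (n + 2) * c 1 τ * y (n + 1) τ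
      + (n + 2) * (n + 1) / 2 * c 2 τ * y n τ := by
  rw [leibniz, Finset.sum_range_succ', Finset.sum_range_succ', Finset.sum_range_succ',
    Finset.sum_eq_zero]
  · have : ((n + 2).choose 2 : ℂ) = (n + 2) * (n + 1) / 2 := by
      rw [Nat.cast_choose_two]
      push_cast
      ring
    simp [this]
    ring
  · intro i hi
    rw [Finset.mem_range] at hi
    rw [h _ (by omega), mul_zero]

/-! ### The explicit solution -/

/-- The coefficients of the field at order `p + 1`, with `s = √(p(p+1))`: a solution of the
homogeneous equations for which `τ ↦ -τ` exchanges `φ₀` with `-φ₂` and changes the sign of `φ₁`. -/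
def orderOne (p : ℕ) (s : ℂ) : Fin 3 → ℂ[X] :=
  ![C (p + 1 : ℂ) * yPoly p + (1 - X) * wPoly ^ p, C s * yPoly p,
    C (p + 1 : ℂ) * yPoly p - (1 + X) * wPoly ^ p]

/-- `T₁` such that the propagation equation of `φ₁` at order `p + 2`, with `orderOne` at order
`p + 1`, reads `s u' + s / 2 (a₂ - a₀) + s T₁ = 0`. -/
def lowerOne (m : ℂ) (p : ℕ) : ℂ[X] :=
  C (m * (p + 2)) * (C (1 / 3 : ℂ) * (4 * X ^ 3 - 12 * X) * yPoly p
    - (X ^ 2 - C (1 / 6 : ℂ) * X ^ 4) * wPoly ^ p)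

/-- `T_C` such that the constraint at order `p + 2`, with `orderOne` at order `p + 1`, reads
`τ s u' + s / 2 (a₂ + a₀) - (p + 2) s u - s T_C = 0`. -/
def lowerC (m : ℂ) (p : ℕ) : ℂ[X] :=
  C (m * (p + 2)) * ((2 * X ^ 2 - X ^ 4) * yPoly p
    + (C (4 / 3 : ℂ) * X ^ 3 - C (1 / 3 : ℂ) * X ^ 5) * wPoly ^ p
    + C ((p + 1) / 2 : ℂ) * (-4 * X ^ 2 + C (2 / 3 : ℂ) * X ^ 4) * yPoly p
    - (X ^ 2 - C (1 / 6 : ℂ) * X ^ 4) * (C (p + 1 : ℂ) * yPoly p - X * wPoly ^ p))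

/-- The coefficients of the field at order `p + 2`. Those of `φ₀` and `φ₂` are obtained from that of
`φ₁` by solving its propagation equation and the constraint algebraically. -/
def orderTwo (m : ℂ) (p : ℕ) (s : ℂ) : Fin 3 → ℝ → ℂ :=
  ![fun τ => (p + 2) * uForm m p τ + (1 - τ) * duForm m p τ
      + (lowerC m p + lowerOne m p).eval (τ : ℂ),
    fun τ => s * uForm m p τ,
    fun τ => (p + 2) * uForm m p τ - (1 + τ) * duForm m p τ
      + (lowerC m p - lowerOne m p).eval (τ : ℂ)]

/-- The solution in the sectors with `q = p`. It does not depend on `k`, because the transport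
equations do not. Orders above `p + 2` are set to `0`; they do not enter the equations of order
at most `p + 2`, in which `c¹ = 0` at `ρ = 0` multiplies the coefficient of order `p + 3`. -/
def explicitSolution (m : ℝ) (p : ℕ) (j : Fin 3) (n : ℕ) : ℝ → ℂ :=
  if n = p + 1 then fun τ : ℝ => (orderOne p (ladder p) j).eval (τ : ℂ)
  else if n = p + 2 then orderTwo m p (ladder p) j
  else fun _ => 0

theorem explicitSolution_of_lt (m : ℝ) {p n : ℕ} (hn : n < p + 1) (j : Fin 3) :
    explicitSolution m p j n = fun _ => 0 := by
  rw [explicitSolution, if_neg (by omega), if_neg (by omega)]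

theorem explicitSolution_add_one (m : ℝ) (p : ℕ) (j : Fin 3) :
    explicitSolution m p j (p + 1) = fun τ : ℝ => (orderOne p (ladder p) j).eval (τ : ℂ) := by
  rw [explicitSolution, if_pos rfl]

theorem explicitSolution_add_two (m : ℝ) (p : ℕ) (j : Fin 3) :
    explicitSolution m p j (p + 2) = orderTwo m p (ladder p) j := by
  rw [explicitSolution, if_neg (by omega), if_pos rfl]

theorem explicitSolution_eq_zero (m : ℝ) {p : ℕ} (j : Fin 3) (τ : ℝ) :
    ∀ n < p + 1, explicitSolution m p j n τ = 0 := fun n hn => by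
  rw [explicitSolution_of_lt m hn]

theorem dTau_explicitSolution_eq_zero (m : ℝ) {p : ℕ} (j : Fin 3) (τ : ℝ) :
    ∀ n < p + 1, dTau (explicitSolution m p j) n τ = 0 := fun n hn => by
  rw [dTau, explicitSolution_of_lt m hn, deriv_const]

theorem dRho_explicitSolution_eq_zero (m : ℝ) {p : ℕ} (j : Fin 3) (τ : ℝ) :
    ∀ n < p, dRho (explicitSolution m p j) n τ = 0 := fun n hn => by
  rw [dRho, explicitSolution_of_lt m (by omega)]

theorem dTau_explicitSolution_add_one (m : ℝ) (p : ℕ) (j : Fin 3) (τ : ℝ) :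
    dTau (explicitSolution m p j) (p + 1) τ
      = (derivative (orderOne p (ladder p) j)).eval (τ : ℂ) := by
  rw [dTau, explicitSolution_add_one]
  exact (hasDerivAt_eval_ofReal _ τ).deriv

theorem dTau_explicitSolution_add_two {m : ℝ} {p : ℕ} {j : Fin 3} {τ : ℝ} {d : ℂ}
    (h : HasDerivAt (orderTwo m p (ladder p) j) d τ) :
    dTau (explicitSolution m p j) (p + 2) τ = d := by
  rw [dTau, explicitSolution_add_two]
  exact h.deriv

theorem ladder_mul_self (p : ℕ) : (ladder p : ℂ) * ladder p = p * (p + 1) := by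
  have : ladder p * ladder p = p * (p + 1) := Real.mul_self_sqrt (by positivity)
  exact_mod_cast this

theorem ladder_ne_zero {p : ℕ} (hp : 1 ≤ p) : (ladder p : ℂ) ≠ 0 := by
  intro h
  have h1 := ladder_mul_self p
  rw [h, mul_zero] at h1
  have : p * (p + 1) = 0 := by exact_mod_cast h1.symm
  rcases Nat.mul_eq_zero.1 this with h | h <;> omega

section Derivatives

variable {m : ℂ} {p : ℕ} {τ : ℝ} {ddu : ℂ}

theorem hasDerivAt_orderTwo_zero (hp : 1 ≤ p) (hτ : τ ∈ Set.Ioo (-1 : ℝ) 1)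
    (hd : HasDerivAt (duForm m p) ddu τ) (s : ℂ) :
    HasDerivAt (orderTwo m p s 0) ((p + 1) * duForm m p τ + (1 - τ) * ddu
      + (derivative (lowerC m p + lowerOne m p)).eval (τ : ℂ)) τ := by
  refine ((((hasDerivAt_uForm m hp hτ).const_mul (p + 2 : ℂ)).add
    ((((hasDerivAt_id τ).ofReal_comp).const_sub 1).mul hd)).add
    (hasDerivAt_eval_ofReal (lowerC m p + lowerOne m p) τ)).congr_deriv ?_
  simp only [id, Complex.ofReal_one]
  ring

theorem hasDerivAt_orderTwo_one (hp : 1 ≤ p) (hτ : τ ∈ Set.Ioo (-1 : ℝ) 1) (s : ℂ) :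
    HasDerivAt (orderTwo m p s 1) (s * duForm m p τ) τ :=
  (hasDerivAt_uForm m hp hτ).const_mul s

theorem hasDerivAt_orderTwo_two (hp : 1 ≤ p) (hτ : τ ∈ Set.Ioo (-1 : ℝ) 1)
    (hd : HasDerivAt (duForm m p) ddu τ) (s : ℂ) :
    HasDerivAt (orderTwo m p s 2) ((p + 1) * duForm m p τ - (1 + τ) * ddu
      + (derivative (lowerC m p - lowerOne m p)).eval (τ : ℂ)) τ := by
  refine ((((hasDerivAt_uForm m hp hτ).const_mul (p + 2 : ℂ)).sub
    ((((hasDerivAt_id τ).ofReal_comp).const_add 1).mul hd)).add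
    (hasDerivAt_eval_ofReal (lowerC m p - lowerOne m p) τ)).congr_deriv ?_
  simp only [id, Complex.ofReal_one]
  ring

theorem differentiableAt_orderTwo (hp : 1 ≤ p) (hτ : τ ∈ Set.Ioo (-1 : ℝ) 1) (s : ℂ) (j : Fin 3) :
    DifferentiableAt ℝ (orderTwo m p s j) τ := by
  obtain ⟨ddu, hd, -⟩ := exists_hasDerivAt_duForm m hp hτ
  fin_cases j
  · exact (hasDerivAt_orderTwo_zero hp hτ hd s).differentiableAt
  · exact (hasDerivAt_orderTwo_one hp hτ s).differentiableAt
  · exact (hasDerivAt_orderTwo_two hp hτ hd s).differentiableAt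

end Derivatives

theorem transport_of_lt (m : ℝ) {p n : ℕ} (hn : n < p + 1) (τ : ℝ) :
    Transport0 m p (explicitSolution m p) n τ ∧ Transport1 m p (explicitSolution m p) n τ ∧
    Transport2 m p (explicitSolution m p) n τ ∧ TransportC m p (explicitSolution m p) n τ := by
  have hy : ∀ j, ∀ k ≤ n, explicitSolution m p j k τ = 0 := fun j k hk =>
    explicitSolution_eq_zero m j τ k (by omega)
  have hdt : ∀ j, ∀ k ≤ n, dTau (explicitSolution m p j) k τ = 0 := fun j k hk =>
    dTau_explicitSolution_eq_zero m j τ k (by omega)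
  have hdr : ∀ j, leibniz (c1 m) (dRho (explicitSolution m p j)) n τ = 0 := fun j => by
    rw [leibniz_self]
    · simp [c1]
    · intro k hk
      exact dRho_explicitSolution_eq_zero m j τ k (by omega)
  simp only [Transport0, Transport1, Transport2, TransportC, hdr, leibniz_eq_zero _ (hy _),
    leibniz_eq_zero _ (hdt _), hdt _ n le_rfl]
  simp

theorem transport_add_one (m : ℝ) (p : ℕ) (τ : ℝ) :
    Transport0 m p (explicitSolution m p) (p + 1) τ ∧
    Transport1 m p (explicitSolution m p) (p + 1) τ ∧
    Transport2 m p (explicitSolution m p) (p + 1) τ ∧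
    TransportC m p (explicitSolution m p) (p + 1) τ := by
  have hy := fun j => explicitSolution_eq_zero m (p := p) j τ
  have hdt := fun j => dTau_explicitSolution_eq_zero m (p := p) j τ
  have hdr := fun j => dRho_explicitSolution_eq_zero m (p := p) j τ
  have h1 := congrArg (eval (τ : ℂ)) (wPoly_mul_derivative_pow p)
  have hs := ladder_mul_self p
  simp only [Transport0, Transport1, Transport2, TransportC, leibniz_self _ (hy _),
    leibniz_self _ (hdt _), leibniz_add_one _ (hdr _), dTau_explicitSolution_add_one, dRho,
    explicitSolution_add_one]
  simp only [orderOne, oneSubC0, oneAddC0, c0, c1, cpm, conn0, conn1, conn2, connC, f,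
    xiDivSqrtTwo, chi2, chih, Matrix.cons_val_zero, Matrix.cons_val_one, Matrix.cons_val,
    derivative_add, derivative_sub, derivative_mul, derivative_yPoly, derivative_C, derivative_X,
    derivative_one, eval_add, eval_sub, eval_mul, eval_C, eval_X, eval_one, eval_zero, eval_pow,
    eval_neg, eval_ofNat, eval_natCast, eval_wPoly, if_true, Complex.ofReal_zero,
    Complex.ofReal_one] at h1 ⊢
  generalize (derivative (wPoly ^ p)).eval (τ : ℂ) = D at *
  generalize (yPoly p).eval (τ : ℂ) = y at *
  generalize (1 - (τ : ℂ) ^ 2) ^ p = W at *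
  generalize (ladder p : ℂ) = s at *
  push_cast
  refine ⟨?_, ?_, ?_, ?_⟩
  · linear_combination h1 + y * hs
  · ring
  · linear_combination -h1 - y * hs
  · ring

theorem transport_add_two (m : ℝ) {p : ℕ} (hp : 1 ≤ p) {τ : ℝ} (hτ : τ ∈ Set.Ioo (-1 : ℝ) 1) :
    Transport0 m p (explicitSolution m p) (p + 2) τ ∧
    Transport1 m p (explicitSolution m p) (p + 2) τ ∧
    Transport2 m p (explicitSolution m p) (p + 2) τ ∧
    TransportC m p (explicitSolution m p) (p + 2) τ := by
  have hy := fun j => explicitSolution_eq_zero m (p := p) j τ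
  have hdt := fun j => dTau_explicitSolution_eq_zero m (p := p) j τ
  have hdr := fun j => dRho_explicitSolution_eq_zero m (p := p) j τ
  obtain ⟨r, rfl⟩ : ∃ r, p = r + 1 := ⟨p - 1, by omega⟩
  have h1 := congrArg (eval (τ : ℂ)) (derivative_wPoly_pow_succ r)
  have hs := ladder_mul_self (r + 1)
  obtain ⟨ddu, hd, hu⟩ := exists_hasDerivAt_duForm m hp hτ
  have d0 := dTau_explicitSolution_add_two (hasDerivAt_orderTwo_zero hp hτ hd (ladder (r + 1)))
  have d1 := dTau_explicitSolution_add_two (m := m)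
    (hasDerivAt_orderTwo_one hp hτ (ladder (r + 1)))
  have d2 := dTau_explicitSolution_add_two (hasDerivAt_orderTwo_two hp hτ hd (ladder (r + 1)))
  simp only [Transport0, Transport1, Transport2, TransportC, leibniz_add_one _ (hy _),
    leibniz_add_one _ (hdt _), leibniz_add_two _ (hdr _), d0, d1, d2,
    dTau_explicitSolution_add_one, dRho, explicitSolution_add_one, explicitSolution_add_two]
  clear d0 d1 d2
  simp only [orderOne, orderTwo, lowerC, lowerOne, source, oneSubC0, oneAddC0, c0, c1, cpm, conn0,
    conn1, conn2, connC, f,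
    xiDivSqrtTwo, chi2, chih, Matrix.cons_val_zero, Matrix.cons_val_one, Matrix.cons_val,
    derivative_add, derivative_sub, derivative_mul, derivative_yPoly, derivative_C, derivative_X,
    derivative_X_pow, derivative_ofNat, derivative_neg,
    derivative_one, eval_add, eval_sub, eval_mul, eval_C, eval_X, eval_one, eval_zero, eval_pow,
    eval_neg, eval_ofNat, eval_natCast, eval_wPoly, if_true, if_false, one_ne_zero,
    Nat.add_sub_cancel, pow_succ (1 - (τ : ℂ) ^ 2) r] at h1 hu ⊢
  rw [h1]
  generalize (yPoly (r + 1)).eval (τ : ℂ) = y at *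
  generalize (1 - (τ : ℂ) ^ 2) ^ r = W at *
  generalize (ladder (r + 1) : ℂ) = s at *
  generalize uForm m (r + 1) τ = u at *
  generalize duForm m (r + 1) τ = du at *
  push_cast at *
  refine ⟨?_, ?_, ?_, ?_⟩
  -- Both remaining equations are `w u'' + 2 (p + 1) (τ u' - u) = S`, up to `s² = p (p + 1)`.
  · linear_combination hu + (u + (r + 3) * (m * (τ ^ 2 - 1 / 6 * τ ^ 4)) * y) * hs
  · ring
  · linear_combination -hu - (u + (r + 3) * (m * (τ ^ 2 - 1 / 6 * τ ^ 4)) * y) * hs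
  · ring

/-! ### Uniqueness -/

/-- The linear vector field of the homogeneous propagation equations of order `n`. -/
def propagation (n : ℂ) (s : ℂ) (τ : ℝ) (x : Fin 3 → ℂ) : Fin 3 → ℂ :=
  ![((n - 1) * x 0 - s * x 1) / (1 + τ), s / 2 * (x 0 - x 2),
    (s * x 1 - (n - 1) * x 2) / (1 - τ)]

/-- The field is singular at `τ = ±1`, so that the Lipschitz constant is uniform only on compact
subintervals of `(-1, 1)`. -/
theorem lipschitzWith_propagation (n s : ℂ) {τ b : ℝ} (hb : b < 1) (hτ : τ ∈ Set.Ioo (-b) b) :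
    LipschitzWith (Real.toNNReal ((‖n - 1‖ + ‖s‖) / (1 - b) + ‖s‖)) (propagation n s τ) := by
  set K := (‖n - 1‖ + ‖s‖) / (1 - b) + ‖s‖
  have hb' : 0 < 1 - b := by linarith
  have hK : 0 ≤ K := by positivity
  refine LipschitzWith.of_dist_le_mul fun x y => ?_
  rw [Real.coe_toNNReal _ hK, dist_eq_norm, dist_eq_norm]
  have hx : ∀ i, ‖x i - y i‖ ≤ ‖x - y‖ := fun i => norm_le_pi_norm (x - y) i
  have hden : ∀ (z c : ℂ), 1 - b ≤ ‖c‖ → ‖z‖ ≤ (‖n - 1‖ + ‖s‖) * ‖x - y‖ →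
      ‖z / c‖ ≤ K * ‖x - y‖ := by
    intro z c hc hz
    rw [norm_div]
    calc ‖z‖ / ‖c‖ ≤ (‖n - 1‖ + ‖s‖) * ‖x - y‖ / (1 - b) := by gcongr
      _ = (‖n - 1‖ + ‖s‖) / (1 - b) * ‖x - y‖ := by ring
      _ ≤ K * ‖x - y‖ := by
        gcongr
        exact le_add_of_nonneg_right (norm_nonneg s)
  have hsum : ∀ i j, ‖(n - 1) * (x i - y i) - s * (x j - y j)‖
      ≤ (‖n - 1‖ + ‖s‖) * ‖x - y‖ := fun i j => by
    refine (norm_sub_le _ _).trans ?_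
    rw [norm_mul, norm_mul, add_mul]
    gcongr <;> exact hx _
  have hnorm : ∀ r : ℝ, 1 - b ≤ r → 1 - b ≤ ‖(r : ℂ)‖ := fun r hr => by
    rw [Complex.norm_real]
    exact hr.trans (le_abs_self r)
  refine (pi_norm_le_iff_of_nonneg (by positivity)).2 fun i => ?_
  fin_cases i
  · have : (propagation n s τ x - propagation n s τ y) 0
        = ((n - 1) * (x 0 - y 0) - s * (x 1 - y 1)) / ((1 + τ : ℝ) : ℂ) := by
      simp only [propagation, Pi.sub_apply, Matrix.cons_val_zero]
      push_cast
      ring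
    exact this ▸ hden _ _ (hnorm _ (by linarith [hτ.1])) (hsum 0 1)
  · have : (propagation n s τ x - propagation n s τ y) 1
        = s / 2 * ((x 0 - y 0) - (x 2 - y 2)) := by
      simp only [propagation, Pi.sub_apply, Matrix.cons_val_one, Matrix.cons_val_zero]
      ring
    refine this ▸ ?_
    calc ‖s / 2 * ((x 0 - y 0) - (x 2 - y 2))‖
        ≤ ‖s‖ / 2 * (‖x - y‖ + ‖x - y‖) := by
          rw [norm_mul, norm_div, Complex.norm_two]
          gcongr
          exact (norm_sub_le _ _).trans (add_le_add (hx 0) (hx 2))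
      _ = ‖s‖ * ‖x - y‖ := by ring
      _ ≤ K * ‖x - y‖ := by
        gcongr
        exact le_add_of_nonneg_left (by positivity)
  · have : (propagation n s τ x - propagation n s τ y) 2
        = -((n - 1) * (x 2 - y 2) - s * (x 1 - y 1)) / ((1 - τ : ℝ) : ℂ) := by
      simp only [propagation, Pi.sub_apply, Matrix.cons_val]
      push_cast
      ring
    exact this ▸ hden _ _ (hnorm _ (by linarith [hτ.2])) (by rw [norm_neg]; exact hsum 2 1)

theorem propagation_zero (n s : ℂ) (τ : ℝ) : propagation n s τ 0 = 0 := by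
  ext i
  fin_cases i <;> simp [propagation]

theorem eq_zero_of_hasDerivAt_propagation {n s : ℂ} {x : ℝ → Fin 3 → ℂ}
    (hx : ∀ τ ∈ Set.Ioo (-1 : ℝ) 1, HasDerivAt x (propagation n s τ (x τ)) τ) (h0 : x 0 = 0)
    {τ : ℝ} (hτ : τ ∈ Set.Ioo (-1 : ℝ) 1) : x τ = 0 := by
  have hτ' : |τ| < 1 := abs_lt.2 hτ
  obtain ⟨b, hτb, hb⟩ := exists_between hτ'
  have hb0 : 0 < b := (abs_nonneg τ).trans_lt hτb
  have hsub : Set.Ioo (-b) b ⊆ Set.Ioo (-1 : ℝ) 1 :=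
    Set.Ioo_subset_Ioo (by linarith) hb.le
  exact ODE_solution_unique_of_mem_Ioo (v := propagation n s) (s := fun _ => Set.univ) (t₀ := 0)
    (g := fun _ => 0)
    (fun t ht => (lipschitzWith_propagation n s hb ht).lipschitzOnWith)
    ⟨by linarith, hb0⟩ (fun t ht => ⟨hx t (hsub ht), trivial⟩)
    (fun t _ => ⟨by rw [propagation_zero]; exact hasDerivAt_const t _, trivial⟩) h0
    (abs_lt.1 hτb)

theorem leibniz_sub (c : ℕ → ℝ → ℝ) {y z : ℕ → ℝ → ℂ} {n : ℕ} {τ : ℝ}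
    (h : ∀ k < n, y k τ = z k τ) :
    leibniz c y n τ - leibniz c z n τ = c 0 τ * (y n τ - z n τ) := by
  have h2 := leibniz_self c (y := fun k t => y k t - z k t) (n := n) (τ := τ)
    fun k hk => by simp [h k hk]
  rw [← h2]
  simp only [leibniz, ← Finset.sum_sub_distrib, mul_sub]

/-- Although `∂_ρ` raises the order, `c¹ ∂_ρ` does not: `c¹ = ρ + O(ρ²)`. -/
theorem leibniz_c1_dRho_sub (m : ℝ) {y z : ℕ → ℝ → ℂ} {n : ℕ} {τ : ℝ}
    (h : ∀ k < n, y k τ = z k τ) :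
    leibniz (c1 m) (dRho y) n τ - leibniz (c1 m) (dRho z) n τ = n * (y n τ - z n τ) := by
  rcases n with _ | n
  · simp [leibniz, c1]
  · have h2 := leibniz_add_one (c1 m) (y := dRho fun k t => y k t - z k t) (n := n) (τ := τ)
      fun k hk => by simp [dRho, h (k + 1) (by omega)]
    have h3 : leibniz (c1 m) (dRho y) (n + 1) τ - leibniz (c1 m) (dRho z) (n + 1) τ
        = leibniz (c1 m) (dRho fun k t => y k t - z k t) (n + 1) τ := by
      simp only [leibniz, dRho, ← Finset.sum_sub_distrib, mul_sub]
    rw [h3, h2]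
    simp [c1, dRho]

/-- Solutions in one sector with the same data agree on `(-1, 1)` up to order `q + 2`. The data of
`φ₁` need not be prescribed, since the constraint at `τ = 0` yields `n a₁(0)` from the rest. -/
theorem IsSectorSolution.unique {m : ℝ} {d : InitialData} {q k : ℕ} (hq : 1 ≤ q)
    {a b : Fin 3 → ℕ → ℝ → ℂ} (ha : IsSectorSolution m d q k a) (hb : IsSectorSolution m d q k b) :
    ∀ n ≤ q + 2, ∀ j, ∀ τ ∈ Set.Ioo (-1 : ℝ) 1, a j n τ = b j n τ := by
  intro n
  induction n using Nat.strong_induction_on with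
  | _ n ih =>
  intro hn
  rcases lt_or_ge n q with hnq | hnq
  · intro j τ hτ
    rw [ha.absent j n hnq τ hτ, hb.absent j n hnq τ hτ]
  have hlow : ∀ j, ∀ τ ∈ Set.Ioo (-1 : ℝ) 1, ∀ k < n, a j k τ = b j k τ :=
    fun j τ hτ k hk => ih k hk (by omega) j τ hτ
  have hlow' : ∀ j, ∀ τ ∈ Set.Ioo (-1 : ℝ) 1, ∀ k < n, dTau (a j) k τ = dTau (b j) k τ :=
    fun j τ hτ k hk => Filter.EventuallyEq.deriv_eq
      (Filter.eventuallyEq_of_mem (Ioo_mem_nhds hτ.1 hτ.2) fun t ht => hlow j t ht k hk)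
  have hda : ∀ j, ∀ τ ∈ Set.Ioo (-1 : ℝ) 1, HasDerivAt (a j n) (dTau (a j) n τ) τ :=
    fun j τ hτ => (ha.differentiable j n hn τ hτ).hasDerivAt
  have hdb : ∀ j, ∀ τ ∈ Set.Ioo (-1 : ℝ) 1, HasDerivAt (b j n) (dTau (b j) n τ) τ :=
    fun j τ hτ => (hb.differentiable j n hn τ hτ).hasDerivAt
  have h01 : (0 : ℝ) ∈ Set.Ioo (-1 : ℝ) 1 := by norm_num
  have hzero : (fun j => a j n 0 - b j n 0) = 0 := by
    have e0 : a 0 n 0 - b 0 n 0 = 0 := by rw [ha.initial0 n hn, hb.initial0 n hn, sub_self]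
    have e2 : a 2 n 0 - b 2 n 0 = 0 := by rw [ha.initial2 n hn, hb.initial2 n hn, sub_self]
    have hc := ha.constraint n hn 0 h01
    have hc' := hb.constraint n hn 0 h01
    rw [TransportC] at hc hc'
    have l1 := leibniz_sub (c0 m) (hlow' 1 0 h01)
    have l2 := leibniz_c1_dRho_sub m (hlow 1 0 h01)
    have l3 := leibniz_sub (cpm m) (hlow 2 0 h01)
    have l4 := leibniz_sub (cpm m) (hlow 0 0 h01)
    have l5 := leibniz_sub (connC m) (hlow 1 0 h01)
    simp only [c0, cpm, connC, xiDivSqrtTwo, mul_zero, neg_zero, Complex.ofReal_zero, zero_mul,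
      Complex.ofReal_one, e0, e2] at l1 l3 l4 l5
    have e1 : (n : ℂ) * (a 1 n 0 - b 1 n 0) = 0 := by
      linear_combination hc' - hc - l1 - l2 - l5 + ladder q / 2 * (l3 + l4)
    have e1' := (mul_eq_zero.1 e1).resolve_left (Nat.cast_ne_zero.2 (by omega))
    ext j
    fin_cases j
    · exact e0
    · exact e1'
    · exact e2
  have hode : ∀ τ ∈ Set.Ioo (-1 : ℝ) 1, HasDerivAt (fun t j => a j n t - b j n t)
      (propagation n (ladder q) τ fun j => a j n τ - b j n τ) τ := by
    intro τ hτ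
    have h1 := one_add_ne_zero_of_mem hτ
    have h2 := one_sub_ne_zero_of_mem hτ
    have t0 := ha.transport0 n hn τ hτ
    have t0' := hb.transport0 n hn τ hτ
    have t1 := ha.transport1 n hn τ hτ
    have t1' := hb.transport1 n hn τ hτ
    have t2 := ha.transport2 n hn τ hτ
    have t2' := hb.transport2 n hn τ hτ
    rw [Transport0] at t0 t0'
    rw [Transport1] at t1 t1'
    rw [Transport2] at t2 t2'
    have p0 := leibniz_sub (oneSubC0 m) (hlow' 0 τ hτ)
    have p2 := leibniz_sub (oneAddC0 m) (hlow' 2 τ hτ)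
    have r0 := leibniz_c1_dRho_sub m (hlow 0 τ hτ)
    have r2 := leibniz_c1_dRho_sub m (hlow 2 τ hτ)
    have y0 := leibniz_sub (cpm m) (hlow 0 τ hτ)
    have y1 := leibniz_sub (cpm m) (hlow 1 τ hτ)
    have y2 := leibniz_sub (cpm m) (hlow 2 τ hτ)
    have g0 := leibniz_sub (conn0 m) (hlow 0 τ hτ)
    have g1 := leibniz_sub (conn1 m) (hlow 1 τ hτ)
    have g2 := leibniz_sub (conn2 m) (hlow 2 τ hτ)
    simp only [oneSubC0, oneAddC0, c0, cpm, conn0, conn1, conn2, xiDivSqrtTwo, chi2, chih, f,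
      if_true] at p0 p2 y0 y1 y2 g0 g1 g2
    push_cast at p0 p2 y0 y1 y2 g0 g1 g2
    refine hasDerivAt_pi.2 fun j => ((hda j τ hτ).sub (hdb j τ hτ)).congr_deriv ?_
    fin_cases j
    · change dTau (a 0) n τ - dTau (b 0) n τ
        = ((n - 1) * (a 0 n τ - b 0 n τ) - ladder q * (a 1 n τ - b 1 n τ)) / (1 + τ)
      rw [eq_div_iff h1]
      linear_combination t0 - t0' - p0 + r0 - ladder q * y1 + g0
    · change dTau (a 1) n τ - dTau (b 1) n τ
        = ladder q / 2 * ((a 0 n τ - b 0 n τ) - (a 2 n τ - b 2 n τ))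
      linear_combination t1 - t1' - ladder q / 2 * (y2 - y0) + g1
    · change dTau (a 2) n τ - dTau (b 2) n τ
        = (ladder q * (a 1 n τ - b 1 n τ) - (n - 1) * (a 2 n τ - b 2 n τ)) / (1 - τ)
      rw [eq_div_iff h2]
      linear_combination t2 - t2' - p2 - r2 + ladder q * y1 + g2
  intro j τ hτ
  exact sub_eq_zero.1 (congrFun (eq_zero_of_hasDerivAt_propagation hode hzero hτ) j)

/-! ### The initial data and the logarithms -/

/-- The data with a single nonzero order `q + 1` in each `(q, k)` sector, where `φ₀` and `φ₂` have
the coefficients `1` and `-1`. -/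
def oddData : InitialData where
  coeff0 n q k := if 1 ≤ q ∧ n = q + 1 ∧ k ≤ 2 * q then 1 else 0
  coeff2 n q k := if 1 ≤ q ∧ n = q + 1 ∧ k ≤ 2 * q then -1 else 0
  support0 n q k h := by
    have := (ite_ne_right_iff.1 h).1
    omega
  support2 n q k h := by
    have := (ite_ne_right_iff.1 h).1
    omega
  convergent := by
    refine ⟨1, 1, fun n q k => ?_⟩
    have : (1 : ℝ) ≤ n.factorial := by exact_mod_cast n.factorial_pos
    simp only [one_pow, one_mul]
    constructor <;> split_ifs <;> simp only [norm_neg, norm_one, norm_zero] <;> linarith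

/-- The regularity condition concerns the coefficients of order `q` only, which vanish. -/
theorem oddData_regular : oddData.Regular := fun n k _ _ => by
  simp [oddData]

theorem orderTwo_zero_eq_zero (m : ℂ) {p : ℕ} (hp : 1 ≤ p) (s : ℂ) :
    orderTwo m p s 0 0 = 0 ∧ orderTwo m p s 2 0 = 0 := by
  have hu : uForm m p 0 = 0 := by
    simp [uForm, logForm, gPoly, eval_zero_yPoly]
  have hd : duForm m p 0 = 0 := by
    simp [duForm, logForm, eval_zero_vPoly m hp]
  simp [orderTwo, hu, hd, lowerC, lowerOne, eval_zero_yPoly]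

theorem isSectorSolution_explicitSolution (m : ℝ) {p k : ℕ} (hp : 1 ≤ p) (hk : k ≤ 2 * p) :
    IsSectorSolution m oddData p k (explicitSolution m p) := by
  have hcases : ∀ n ≤ p + 2, n < p + 1 ∨ n = p + 1 ∨ n = p + 2 := fun n hn => by omega
  have htransport : ∀ n ≤ p + 2, ∀ τ ∈ Set.Ioo (-1 : ℝ) 1,
      Transport0 m p (explicitSolution m p) n τ ∧ Transport1 m p (explicitSolution m p) n τ ∧
      Transport2 m p (explicitSolution m p) n τ ∧
      TransportC m p (explicitSolution m p) n τ := by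
    intro n hn τ hτ
    rcases hcases n hn with h | rfl | rfl
    · exact transport_of_lt m h τ
    · exact transport_add_one m p τ
    · exact transport_add_two m hp hτ
  refine ⟨?_, ?_, fun n hn τ hτ => (htransport n hn τ hτ).1,
    fun n hn τ hτ => (htransport n hn τ hτ).2.1, fun n hn τ hτ => (htransport n hn τ hτ).2.2.1,
    fun n hn τ hτ => (htransport n hn τ hτ).2.2.2, ?_, ?_⟩
  · intro j n hn τ hτ
    rcases hcases n hn with h | rfl | rfl
    · rw [explicitSolution_of_lt m h]
      exact differentiableAt_const _
    · rw [explicitSolution_add_one]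
      exact (hasDerivAt_eval_ofReal _ τ).differentiableAt
    · rw [explicitSolution_add_two]
      exact differentiableAt_orderTwo hp hτ _ j
  · intro j n hn τ _
    exact explicitSolution_eq_zero m j τ n (by omega)
  · intro n hn
    rcases hcases n hn with h | rfl | rfl
    · rw [explicitSolution_of_lt m h]
      simp [oddData, h.ne]
    · rw [explicitSolution_add_one]
      simp [oddData, hp, hk, orderOne, eval_zero_yPoly, eval_wPoly]
    · rw [explicitSolution_add_two, (orderTwo_zero_eq_zero m hp _).1]
      simp [oddData]
  · intro n hn
    rcases hcases n hn with h | rfl | rfl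
    · rw [explicitSolution_of_lt m h]
      simp [oddData, h.ne]
    · rw [explicitSolution_add_one]
      simp [oddData, hp, hk, orderOne, eval_zero_yPoly, eval_wPoly]
    · rw [explicitSolution_add_two, (orderTwo_zero_eq_zero m hp _).2]
      simp [oddData]

theorem HasLogDivergences.congr {g h : ℝ → ℂ} (hg : HasLogDivergences g)
    (hgh : ∀ τ ∈ Set.Ioo (-1 : ℝ) 1, h τ = g τ) : HasLogDivergences h := by
  obtain ⟨P, Pm, Pp, hm, hp, hP⟩ := hg
  exact ⟨P, Pm, Pp, hm, hp, fun τ hτ => (hgh τ hτ).trans (hP τ hτ)⟩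

theorem hasLogDivergences_orderTwo {m : ℂ} (hm : m ≠ 0) {p : ℕ} (hp : 1 ≤ p) {s : ℂ} (hs : s ≠ 0)
    (j : Fin 3) : HasLogDivergences (orderTwo m p s j) := by
  set κ := (yPoly p).eval 1
  have hp2 : (p : ℂ) + 2 ≠ 0 := by exact_mod_cast Nat.succ_ne_zero (p + 1)
  have hcp : C (2 * m * (p + 2)) ≠ 0 := C_ne_zero.2 (mul_ne_zero (mul_ne_zero two_ne_zero hm) hp2)
  have hcm : C (-2 * m * (p + 2)) ≠ 0 :=
    C_ne_zero.2 (mul_ne_zero (mul_ne_zero (by norm_num) hm) hp2)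
  have hsC : C s ≠ 0 := C_ne_zero.2 hs
  fin_cases j
  · refine ⟨C (p + 2 : ℂ) * (X * vPoly m p - gPoly m p) + (C 1 - X) * vPoly m p
      + (lowerC m p + lowerOne m p),
      C (-2 * m * (p + 2)) * (C (p + 2 : ℂ) * zPoly p (-κ) + (C 1 - X) * derivative (zPoly p (-κ))),
      C (2 * m * (p + 2)) * (C (p + 2 : ℂ) * zPoly p κ + (C 1 - X) * derivative (zPoly p κ)),
      mul_ne_zero hcm (zPoly_combination_ne_zero hp _ _),
      mul_ne_zero hcp (zPoly_combination_ne_zero hp _ _), fun τ _ => ?_⟩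
    simp only [orderTwo, uForm, duForm, logForm, Fin.zero_eta, Matrix.cons_val_zero, eval_add,
      eval_sub, eval_mul, eval_C, eval_X]
    ring
  · refine ⟨C s * (X * vPoly m p - gPoly m p), C s * (C (-2 * m * (p + 2)) * zPoly p (-κ)),
      C s * (C (2 * m * (p + 2)) * zPoly p κ),
      mul_ne_zero hsC (mul_ne_zero hcm (zPoly_ne_zero _ _)),
      mul_ne_zero hsC (mul_ne_zero hcp (zPoly_ne_zero _ _)), fun τ _ => ?_⟩
    simp only [orderTwo, uForm, logForm, Fin.mk_one, Matrix.cons_val_one, Matrix.cons_val_zero,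
      eval_sub, eval_mul, eval_C, eval_X]
    ring
  · refine ⟨C (p + 2 : ℂ) * (X * vPoly m p - gPoly m p) + (C (-1) - X) * vPoly m p
      + (lowerC m p - lowerOne m p),
      C (-2 * m * (p + 2))
        * (C (p + 2 : ℂ) * zPoly p (-κ) + (C (-1) - X) * derivative (zPoly p (-κ))),
      C (2 * m * (p + 2)) * (C (p + 2 : ℂ) * zPoly p κ + (C (-1) - X) * derivative (zPoly p κ)),
      mul_ne_zero hcm (zPoly_combination_ne_zero hp _ _),
      mul_ne_zero hcp (zPoly_combination_ne_zero hp _ _), fun τ _ => ?_⟩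
    simp only [orderTwo, uForm, duForm, logForm, Fin.reduceFinMk, Matrix.cons_val, eval_add,
      eval_sub, eval_mul, eval_C, eval_X]
    ring

end MaxwellSchwarzschild

end

theorem proposition5 (m : ℝ) (hm : m ≠ 0) :
    ∃ d : MaxwellSchwarzschild.InitialData, d.Regular ∧
      ∀ p : ℕ, 1 ≤ p → ∀ k : ℕ, k ≤ 2 * p →
        (∃ a : Fin 3 → ℕ → ℝ → ℂ, MaxwellSchwarzschild.IsSectorSolution m d p k a) ∧
        ∀ a : Fin 3 → ℕ → ℝ → ℂ, MaxwellSchwarzschild.IsSectorSolution m d p k a →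
          ∀ j : Fin 3, MaxwellSchwarzschild.HasLogDivergences (a j (p + 2)) := by
  refine ⟨MaxwellSchwarzschild.oddData, MaxwellSchwarzschild.oddData_regular,
    fun p hp k hk => ?_⟩
  have hsol := MaxwellSchwarzschild.isSectorSolution_explicitSolution m hp hk
  refine ⟨⟨_, hsol⟩, fun a ha j => ?_⟩
  refine (MaxwellSchwarzschild.hasLogDivergences_orderTwo (Complex.ofReal_ne_zero.2 hm) hp
    (MaxwellSchwarzschild.ladder_ne_zero hp) j).congr fun τ hτ => ?_
  rw [ha.unique hp hsol (p + 2) le_rfl j τ hτ, MaxwellSchwarzschild.explicitSolution_add_two]
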